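/- Let $n\ge 2$, $s\in(0,1)$ and $p\in(1,\infty)$. Then there is a homeomorphism $f$ of the closed cube $[-1,1]^n$ onto itself with the following properties. 1. $f\in W^{s,p}([-1,1]^n,\mathbb R^n)$, that is, $f\in L^p([-1,1]^n,\mathbb R^n)$ and $$\int_{[-1,1]^n}\int_{[-1,1]^n}\frac{|f(x)-f(y)|^p}{|x-y|^{n+sp}}\,dy\,dx<\infty .$$ 2. $f(x)=x$ for every $x\in\partial[-1,1]^n$. 3. $f$ fails the Lusin $(N)$ condition: there is a set $N\subset(-1,1)^n$ of Lebesgue measure zero whose image $f(N)$ has positive Lebesgue (outer) measure. Moreover, $f$ can be chosen to be $\alpha$-Hölder continuous on $[-1,1]^n$ for some $\alpha\in(s,1)$, and the set $N$ in 3 can be chosen to be a Cantor set (a nonempty, compact, perfect, totally disconnected set) whose image $f(N)$ is a Cantor set as well. -/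

import Mathlib

open MeasureTheory Set
open scoped ENNReal NNReal

/-- The closed cube `[-1,1]ⁿ` in Euclidean space. -/
def closedCube (n : ℕ) : Set (EuclideanSpace ℝ (Fin n)) :=
  {x | ∀ i, x i ∈ Icc (-1 : ℝ) 1}

/-- The open cube `(-1,1)ⁿ` in Euclidean space. -/
def openCube (n : ℕ) : Set (EuclideanSpace ℝ (Fin n)) :=
  {x | ∀ i, x i ∈ Ioo (-1 : ℝ) 1}

/-- The `p`-th power of the Gagliardo seminorm,
`∫_Ω ∫_Ω |f(x) - f(y)|ᵖ / |x - y|^(n + s p) dy dx`, with values in `[0,∞]`. -/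
noncomputable def gagliardoEnergy {n m : ℕ} (s p : ℝ) (Ω : Set (EuclideanSpace ℝ (Fin n)))
    (f : EuclideanSpace ℝ (Fin n) → EuclideanSpace ℝ (Fin m)) : ℝ≥0∞ :=
  ∫⁻ x in Ω, ∫⁻ y in Ω,
    ENNReal.ofReal (‖f x - f y‖ ^ p / ‖x - y‖ ^ ((n : ℝ) + s * p))

/-- Membership in the fractional Sobolev (Sobolev–Slobodeckij) space `W^{s,p}(Ω, ℝᵐ)`, for
`0 < s < 1` and `1 ≤ p < ∞`. Only the values of `f` on `Ω` matter. -/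
def MemFracSobolev {n m : ℕ} (s p : ℝ) (Ω : Set (EuclideanSpace ℝ (Fin n)))
    (f : EuclideanSpace ℝ (Fin n) → EuclideanSpace ℝ (Fin m)) : Prop :=
  MemLp f (ENNReal.ofReal p) (volume.restrict Ω) ∧ gagliardoEnergy s p Ω f < ∞

/-- `f` restricts to a homeomorphism of `K` onto `L`. -/
def IsHomeoOn {X Y : Type*} [TopologicalSpace X] [TopologicalSpace Y]
    (f : X → Y) (K : Set X) (L : Set Y) : Prop :=
  ∃ h : K ≃ₜ L, ∀ x : K, (h x : Y) = f x

/-- Lusin's condition (N) on `Ω`: null sets are mapped to null sets. -/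
def LusinN {n : ℕ} (f : EuclideanSpace ℝ (Fin n) → EuclideanSpace ℝ (Fin n))
    (Ω : Set (EuclideanSpace ℝ (Fin n))) : Prop :=
  ∀ N ⊆ Ω, volume N = 0 → volume (f '' N) = 0

/-- A (topological) Cantor set: nonempty, compact, perfect and totally disconnected. -/
structure IsCantorSet {X : Type*} [TopologicalSpace X] (C : Set X) : Prop where
  nonempty : C.Nonempty
  isCompact : IsCompact C
  perfect : Perfect C
  isTotallyDisconnected : IsTotallyDisconnected C

/-!
Remove from `[-1/2, 1/2]` the intervals of radius `c δ^(1/α)` around the multiples of `δ`, for every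
`δ = 2⁻ᵏ`. For small `c` the remaining compact set `F` has positive measure, yet every interval of
length `ℓ ≤ 2` meets the complement of `F` in length at least a constant times `ℓ^(1/α)`. Hence
`x ↦ |(-1, x] \ F|`, rescaled to fix `±1`, is a homeomorphism which collapses `F` to a null set and
whose inverse `g` is `α`-Hölder. Apply `g` to one coordinate, damping the displacement to zero
towards the other faces of the cube. Near the center this maps the null set which is the product of
`g⁻¹(F)` in one coordinate and `F` in the others onto `Fⁿ`. An `α`-Hölder map lies in `W^{s,p}` for
every `s < α`, because `|x - y|^((α - s) p - n)` is locally integrable.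
-/

/-- The neighbourhoods of radius `c (2⁻ᵏ)^β` of the dyadic points `j 2⁻ᵏ`, for all `k` and `j`.
Removing them from an interval leaves a set of positive measure whose complement is nevertheless
quantitatively dense. -/
def dyadicNhds (c β : ℝ) : Set ℝ :=
  ⋃ (k : ℕ) (j : ℤ), Metric.ball (j * (1 / 2 : ℝ) ^ k) (c * ((1 / 2 : ℝ) ^ k) ^ β)

theorem isOpen_dyadicNhds (c β : ℝ) : IsOpen (dyadicNhds c β) :=
  isOpen_iUnion fun _ => isOpen_iUnion fun _ => Metric.isOpen_ball

theorem le_volume_Ioc_inter_dyadicNhds {c β : ℝ} (hc0 : 0 ≤ c) (hc1 : c ≤ 1) (hβ : 1 ≤ β)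
    {x y : ℝ} (hxy : x < y) (hyx : y ≤ x + 2) :
    c * ((y - x) / 6) ^ β ≤ volume.real (Ioc x y ∩ dyadicNhds c β) := by
  obtain ⟨k, hk_lt, hk_le⟩ := exists_nat_pow_near_of_lt_one (x := (y - x) / 3) (y := (1 / 2 : ℝ))
    (by linarith) (by linarith) (by norm_num) (by norm_num)
  set δ : ℝ := (1 / 2 : ℝ) ^ (k + 1) with hδ
  have hδ_pos : 0 < δ := by positivity
  have hδ_le : (y - x) / 6 ≤ δ := by rw [hδ, pow_succ]; linarith
  have hradius : c * δ ^ β ≤ δ := by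
    have hδβ : δ ^ β ≤ δ := Real.rpow_le_self_of_le_one hδ_pos.le
      (pow_le_one₀ (by norm_num) (by norm_num)) hβ
    exact (mul_le_of_le_one_left (by positivity) hc1).trans hδβ
  set j : ℤ := round ((x + y) / 2 / δ)
  have hcenter : dist (j * δ) ((x + y) / 2) ≤ δ / 2 := by
    have h := abs_sub_round ((x + y) / 2 / δ)
    calc dist (j * δ) ((x + y) / 2) = |(x + y) / 2 / δ - j| * δ := by
          rw [dist_comm, Real.dist_eq, ← abs_of_pos hδ_pos, ← abs_mul, abs_of_pos hδ_pos, sub_mul,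
            div_mul_cancel₀ _ hδ_pos.ne']
      _ ≤ 1 / 2 * δ := by gcongr
      _ = δ / 2 := by ring
  have hsub : Metric.ball (j * δ) (c * δ ^ β) ⊆ Ioc x y ∩ dyadicNhds c β := by
    refine subset_inter (Subset.trans ?_ Ioo_subset_Ioc_self)
      (subset_iUnion₂_of_subset (k + 1) j Subset.rfl)
    rw [Real.Ioo_eq_ball]
    exact Metric.ball_subset_ball' (by linarith)
  calc c * ((y - x) / 6) ^ β ≤ 2 * (c * δ ^ β) := by
        have h : c * ((y - x) / 6) ^ β ≤ c * δ ^ β := by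
          have := sub_pos.2 hxy
          gcongr
        linarith [show 0 ≤ c * δ ^ β by positivity]
    _ = volume.real (Metric.ball (j * δ) (c * δ ^ β)) :=
        (Real.volume_real_ball (by positivity)).symm
    _ ≤ volume.real (Ioc x y ∩ dyadicNhds c β) :=
        measureReal_mono hsub (measure_ne_top_of_subset inter_subset_left measure_Ioc_lt_top.ne)

theorem volume_iUnion_ball_inter_Icc_le {δ r : ℝ} (hδ0 : 0 < δ) (hδ1 : δ ≤ 1) (hr0 : 0 ≤ r)
    (hr1 : r ≤ 1) :
    volume ((⋃ j : ℤ, Metric.ball (j * δ) r) ∩ Icc (-1 / 2) (1 / 2)) ≤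
      ENNReal.ofReal (10 * r / δ) := by
  set N : ℤ := ⌊2 / δ⌋ with hN
  have hN_nonneg : 0 ≤ N := Int.floor_nonneg.2 (by positivity)
  have hsub : (⋃ j : ℤ, Metric.ball (j * δ) r) ∩ Icc (-1 / 2) (1 / 2) ⊆
      ⋃ j ∈ Finset.Icc (-N) N, Metric.ball (j * δ) r := by
    rintro t ⟨ht, htI⟩
    obtain ⟨j, hj⟩ := mem_iUnion.1 ht
    have hjN : |j| ≤ N := by
      rw [hN, Int.le_floor, le_div_iff₀ hδ0, Int.cast_abs, ← abs_of_pos hδ0, ← abs_mul]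
      obtain ⟨h1, h2⟩ := abs_lt.1 (Real.dist_eq t _ ▸ Metric.mem_ball.1 hj)
      exact abs_le.2 ⟨by linarith [htI.1], by linarith [htI.2]⟩
    exact mem_biUnion (Finset.mem_coe.2 (Finset.mem_Icc.2 (abs_le.1 hjN))) hj
  have hcard : ((Finset.Icc (-N) N).card : ℝ) ≤ 5 / δ := by
    have hfloor : (N : ℝ) ≤ 2 / δ := Int.floor_le _
    have hone : 1 ≤ 1 / δ := (one_le_div hδ0).2 hδ1
    have hcast : ((Finset.Icc (-N) N).card : ℤ) = 2 * N + 1 := by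
      rw [Int.card_Icc, Int.toNat_of_nonneg (by linarith)]
      ring
    calc ((Finset.Icc (-N) N).card : ℝ) = 2 * N + 1 := by exact_mod_cast hcast
      _ ≤ 2 * (2 / δ) + 1 / δ := by gcongr
      _ = 5 / δ := by ring
  calc volume ((⋃ j : ℤ, Metric.ball (j * δ) r) ∩ Icc (-1 / 2) (1 / 2))
      ≤ ∑ j ∈ Finset.Icc (-N) N, volume (Metric.ball (j * δ) r) :=
        (measure_mono hsub).trans (measure_biUnion_finset_le _ _)
    _ = ENNReal.ofReal ((Finset.Icc (-N) N).card * (2 * r)) := by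
        simp only [Real.volume_ball, Finset.sum_const, nsmul_eq_mul]
        rw [ENNReal.ofReal_mul (Nat.cast_nonneg _), ENNReal.ofReal_natCast]
    _ ≤ ENNReal.ofReal (5 / δ * (2 * r)) := by gcongr
    _ = ENNReal.ofReal (10 * r / δ) := by ring_nf

theorem volume_dyadicNhds_inter_Icc_le {c β : ℝ} (hc0 : 0 ≤ c) (hc1 : c ≤ 1) (hβ : 1 < β) :
    volume (dyadicNhds c β ∩ Icc (-1 / 2) (1 / 2)) ≤
      ENNReal.ofReal (10 * c / (1 - 2 * (1 / 2) ^ β)) := by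
  set θ : ℝ := (1 / 2 : ℝ) ^ β with hθ
  have hθ_lt : 2 * θ < 1 := by
    have h : θ < 1 / 2 := Real.rpow_lt_self_of_lt_one (by norm_num) (by norm_num) hβ
    linarith
  have hpow_le_one (k : ℕ) : (1 / 2 : ℝ) ^ k ≤ 1 := pow_le_one₀ (by norm_num) (by norm_num)
  have hscale (k : ℕ) : volume ((⋃ j : ℤ, Metric.ball (j * (1 / 2 : ℝ) ^ k)
      (c * ((1 / 2 : ℝ) ^ k) ^ β)) ∩ Icc (-1 / 2) (1 / 2)) ≤
      ENNReal.ofReal (10 * c * (2 * θ) ^ k) := by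
    have hradius : c * ((1 / 2 : ℝ) ^ k) ^ β ≤ 1 :=
      mul_le_one₀ hc1 (by positivity) (Real.rpow_le_one (by positivity) (hpow_le_one k)
        (by linarith))
    refine (volume_iUnion_ball_inter_Icc_le (by positivity) (hpow_le_one k) (by positivity)
      hradius).trans_eq ?_
    rw [← Real.rpow_pow_comm (by norm_num), ← hθ, mul_pow, one_div, inv_pow, div_inv_eq_mul]
    ring_nf
  have hsum : Summable fun k : ℕ => 10 * c * (2 * θ) ^ k :=
    (summable_geometric_of_lt_one (by positivity) hθ_lt).mul_left _
  calc volume (dyadicNhds c β ∩ Icc (-1 / 2) (1 / 2))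
      ≤ ∑' k : ℕ, ENNReal.ofReal (10 * c * (2 * θ) ^ k) := by
        rw [dyadicNhds, iUnion_inter]
        exact (measure_iUnion_le _).trans (ENNReal.tsum_le_tsum hscale)
    _ = ENNReal.ofReal (10 * c / (1 - 2 * θ)) := by
        rw [← ENNReal.ofReal_tsum_of_nonneg (fun k => by positivity) hsum, tsum_mul_left,
          tsum_geometric_of_lt_one (by positivity) hθ_lt, div_eq_mul_inv]

theorem exists_isCompact_le_volume_Ioc_diff {β : ℝ} (hβ : 1 < β) :
    ∃ F ⊆ Icc (-1 / 2 : ℝ) (1 / 2), IsCompact F ∧ 0 < volume F ∧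
      ∃ c > 0, ∀ x y, x ≤ y → y ≤ x + 2 → c * (y - x) ^ β ≤ volume.real (Ioc x y \ F) := by
  have hθ : (1 / 2 : ℝ) ^ β < 1 / 2 :=
    Real.rpow_lt_self_of_lt_one (by norm_num) (by norm_num) hβ
  have hθ_pos : 0 < (1 / 2 : ℝ) ^ β := by positivity
  set c : ℝ := (1 - 2 * (1 / 2 : ℝ) ^ β) / 20 with hc
  have hc_pos : 0 < c := by rw [hc]; linarith
  have hc_le : c ≤ 1 := by rw [hc]; linarith
  refine ⟨Icc (-1 / 2) (1 / 2) \ dyadicNhds c β, sdiff_subset,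
    isCompact_Icc.diff (isOpen_dyadicNhds c β), ?_, c * (1 / 6) ^ β, by positivity, ?_⟩
  · have hremoved : volume (dyadicNhds c β ∩ Icc (-1 / 2) (1 / 2)) ≤ ENNReal.ofReal (1 / 2) := by
      refine (volume_dyadicNhds_inter_Icc_le hc_pos.le hc_le hβ).trans_eq (congrArg _ ?_)
      rw [div_eq_iff (by linarith), hc]
      ring
    rw [← sdiff_inter_self_eq_sdiff]
    refine lt_of_lt_of_le (tsub_pos_of_lt (hremoved.trans_lt ?_)) le_measure_sdiff
    rw [Real.volume_Icc]
    exact (ENNReal.ofReal_lt_ofReal_iff (by norm_num)).2 (by norm_num)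
  · intro x y hxy hyx
    rcases hxy.eq_or_lt with rfl | hlt
    · simp [Real.zero_rpow (zero_lt_one.trans hβ).ne']
    · calc c * (1 / 6) ^ β * (y - x) ^ β = c * ((y - x) / 6) ^ β := by
            rw [mul_assoc, ← Real.mul_rpow (by norm_num) (by linarith), one_div_mul_eq_div]
        _ ≤ volume.real (Ioc x y ∩ dyadicNhds c β) :=
            le_volume_Ioc_inter_dyadicNhds hc_pos.le hc_le hβ.le hlt hyx
        _ ≤ volume.real (Ioc x y \ (Icc (-1 / 2) (1 / 2) \ dyadicNhds c β)) :=
            measureReal_mono (fun t ht => ⟨ht.1, fun h => h.2 ht.2⟩)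
              (measure_ne_top_of_subset sdiff_subset measure_Ioc_lt_top.ne)

/-- The signed length of the part of the line up to `x` that lies outside `F`, normalized so that
it agrees with `x` to the left of `F`. -/
noncomputable def complLength (F : Set ℝ) (x : ℝ) : ℝ :=
  x - volume.real (F ∩ Iic x)

theorem complLength_sub {F : Set ℝ} (hF : MeasurableSet F) (hF_fin : volume F ≠ ∞) {x y : ℝ}
    (hxy : x ≤ y) : complLength F y - complLength F x = volume.real (Ioc x y \ F) := by
  have hfin (s : Set ℝ) : volume (F ∩ s) ≠ ∞ := measure_ne_top_of_subset inter_subset_left hF_fin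
  have hIic : volume.real (F ∩ Iic y) = volume.real (F ∩ Iic x) + volume.real (F ∩ Ioc x y) := by
    rw [← Iic_union_Ioc_eq_Iic hxy, inter_union_distrib_left]
    exact measureReal_union ((Iic_disjoint_Ioc le_rfl).mono inter_subset_right inter_subset_right)
      (hF.inter measurableSet_Ioc) (hfin _) (hfin _)
  have hIoc := measureReal_inter_add_sdiff (μ := volume) (s := Ioc x y) hF measure_Ioc_lt_top.ne
  rw [Real.volume_real_Ioc_of_le hxy, inter_comm] at hIoc
  rw [complLength, complLength]
  linarith

theorem continuous_complLength {F : Set ℝ} (hF : MeasurableSet F) (hF_fin : volume F ≠ ∞) :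
    Continuous (complLength F) := by
  refine LipschitzWith.continuous (K := 1) (LipschitzWith.of_le_add fun x y => ?_)
  rcases le_total x y with hxy | hyx
  · linarith [complLength_sub hF hF_fin hxy, dist_nonneg (x := x) (y := y),
      measureReal_nonneg (μ := volume) (s := Ioc x y \ F)]
  · have h : volume.real (Ioc y x \ F) ≤ volume.real (Ioc y x) :=
      measureReal_mono sdiff_subset measure_Ioc_lt_top.ne
    rw [Real.volume_real_Ioc_of_le hyx] at h
    rw [Real.dist_eq, abs_of_nonneg (sub_nonneg.2 hyx)]
    linarith [complLength_sub hF hF_fin hyx]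

theorem surjective_complLength {F : Set ℝ} (hF : MeasurableSet F) (hF_fin : volume F ≠ ∞) :
    Function.Surjective (complLength F) := fun u =>
  mem_range_of_exists_le_of_exists_ge (continuous_complLength hF hF_fin)
    ⟨u, sub_le_self _ measureReal_nonneg⟩
    ⟨u + volume.real F, le_sub_iff_add_le.2 <| by
      gcongr
      exact inter_subset_left⟩

theorem exists_orderIso_sub_eq_volume_Ioc_diff {F : Set ℝ} (hF : MeasurableSet F)
    (hF_fin : volume F ≠ ∞) (hF_compl : ∀ x y, x < y → 0 < volume.real (Ioc x y \ F)) :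
    ∃ e : ℝ ≃o ℝ, e (-1) = -1 ∧ e 1 = 1 ∧
      ∃ a > 0, ∀ x y, x ≤ y → e y - e x = a * volume.real (Ioc x y \ F) := by
  have hmono : StrictMono (complLength F) := fun x y hxy =>
    sub_pos.1 (complLength_sub hF hF_fin hxy.le ▸ hF_compl x y hxy)
  have hlen : 0 < complLength F 1 - complLength F (-1) := sub_pos.2 (hmono (by norm_num))
  set a : ℝ := 2 / (complLength F 1 - complLength F (-1))
  have ha : 0 < a := by positivity
  let e : ℝ ≃o ℝ := (hmono.orderIsoOfSurjective _ (surjective_complLength hF hF_fin)).trans <|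
    (OrderIso.subRight (complLength F (-1))).trans <|
      (OrderIso.mulLeft₀ a ha).trans (OrderIso.subRight 1)
  have he (x : ℝ) : e x = a * (complLength F x - complLength F (-1)) - 1 := rfl
  refine ⟨e, by simp [he], ?_, a, ha, fun x y hxy => ?_⟩
  · rw [he, div_mul_cancel₀ _ hlen.ne']
    norm_num
  · rw [he, he, ← complLength_sub hF hF_fin hxy]
    ring

theorem volume_image_eq_zero_of_sub_eq {F : Set ℝ} (hF : MeasurableSet F) {e : ℝ ≃o ℝ} {a : ℝ}
    (he : ∀ x y, x ≤ y → e y - e x = a * volume.real (Ioc x y \ F)) :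
    volume (e '' F) = 0 := by
  have hemb : MeasurableEmbedding e := e.toHomeomorph.measurableEmbedding
  have hcomap : volume.comap e = ENNReal.ofReal a • volume.restrict Fᶜ := by
    refine Measure.ext_of_Ioc' _ _ (fun x y _ => ?_) fun x y hxy => ?_
    · rw [hemb.comap_apply, OrderIso.image_Ioc]
      exact measure_Ioc_lt_top.ne
    · rw [hemb.comap_apply, OrderIso.image_Ioc, Real.volume_Ioc, he x y hxy.le,
        ENNReal.ofReal_mul' measureReal_nonneg, measureReal_def,
        ENNReal.ofReal_toReal (measure_ne_top_of_subset sdiff_subset measure_Ioc_lt_top.ne),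
        Measure.smul_apply, Measure.restrict_apply measurableSet_Ioc, sdiff_eq, smul_eq_mul]
  rw [← hemb.comap_apply, hcomap, Measure.smul_apply, Measure.restrict_apply hF, inter_compl_self,
    measure_empty, smul_zero]

theorem isTotallyDisconnected_of_volume_eq_zero {A : Set ℝ} (hA : volume A = 0) :
    IsTotallyDisconnected A := by
  refine isTotallyDisconnected_iff_lt.2 fun x _ y _ hxy => ?_
  by_contra! h
  have hsub : Ioo x y ⊆ A := fun z hz => by_contra fun hzA => h z hzA hz
  exact (Measure.measure_Ioo_pos volume).2 hxy |>.ne' (measure_mono_null hsub hA)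

theorem holderOnWith_of_dist_le {X Y : Type*} [PseudoMetricSpace X] [PseudoMetricSpace Y]
    {f : X → Y} {s : Set X} {K α : ℝ≥0}
    (h : ∀ x ∈ s, ∀ y ∈ s, dist (f x) (f y) ≤ K * dist x y ^ (α : ℝ)) : HolderOnWith K α f s := by
  intro x hx y hy
  rw [edist_dist, edist_dist, ENNReal.ofReal_rpow_of_nonneg dist_nonneg α.coe_nonneg,
    ← ENNReal.ofReal_coe_nnreal, ← ENNReal.ofReal_mul K.coe_nonneg]
  exact ENNReal.ofReal_le_ofReal (h x hx y hy)

theorem exists_holderOnWith_symm {e : ℝ ≃o ℝ} {s : Set ℝ} {c : ℝ} {α : ℝ≥0} (hc : 0 < c)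
    (hα : α ≠ 0)
    (h : ∀ x ∈ s, ∀ y ∈ s, x ≤ y → c * (y - x) ^ (α : ℝ)⁻¹ ≤ e y - e x) :
    ∃ K : ℝ≥0, HolderOnWith K α e.symm (e '' s) := by
  refine ⟨⟨(c ^ (α : ℝ))⁻¹, by positivity⟩, holderOnWith_of_dist_le ?_⟩
  rintro _ ⟨x, hx, rfl⟩ _ ⟨y, hy, rfl⟩
  wlog hxy : x ≤ y generalizing x y
  · simpa only [dist_comm] using this y hy x hx (le_of_not_ge hxy)
  have hα_ne : (α : ℝ) ≠ 0 := NNReal.coe_ne_zero.2 hα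
  have hsub : 0 ≤ y - x := sub_nonneg.2 hxy
  have hpow : c ^ (α : ℝ) * (y - x) ≤ (e y - e x) ^ (α : ℝ) := by
    calc c ^ (α : ℝ) * (y - x) = (c * (y - x) ^ (α : ℝ)⁻¹) ^ (α : ℝ) := by
          rw [Real.mul_rpow hc.le (by positivity), Real.rpow_inv_rpow hsub hα_ne]
      _ ≤ (e y - e x) ^ (α : ℝ) :=
          Real.rpow_le_rpow (by positivity) (h x hx y hy hxy) α.coe_nonneg
  simp only [OrderIso.symm_apply_apply]
  rw [dist_comm, Real.dist_eq, dist_comm, Real.dist_eq, abs_of_nonneg hsub,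
    abs_of_nonneg (sub_nonneg.2 (e.monotone hxy))]
  exact (le_inv_mul_iff₀ (by positivity)).2 hpow

theorem exists_orderIso_holderOnWith {α : ℝ≥0} (hα0 : 0 < α) (hα1 : α < 1) :
    ∃ g : ℝ ≃o ℝ, g (-1) = -1 ∧ g 1 = 1 ∧ (∃ K : ℝ≥0, HolderOnWith K α g (Icc (-1) 1)) ∧
      ∃ F ⊆ Icc (-1 / 2 : ℝ) (1 / 2), IsCompact F ∧ IsTotallyDisconnected F ∧ 0 < volume F ∧
        volume (g ⁻¹' F) = 0 := by
  obtain ⟨F, hF_sub, hF, hF_pos, c, hc, hF_compl⟩ :=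
    exists_isCompact_le_volume_Ioc_diff (β := (α : ℝ)⁻¹) ((one_lt_inv₀ hα0).2 hα1)
  have hF_Ioc_pos (x y : ℝ) (hxy : x < y) : 0 < volume.real (Ioc x y \ F) := by
    have hlt : x < min y (x + 2) := lt_min hxy (by linarith)
    have hsub : Ioc x (min y (x + 2)) \ F ⊆ Ioc x y \ F := by
      gcongr
      exact min_le_left _ _
    have hpos : 0 < c * (min y (x + 2) - x) ^ (α : ℝ)⁻¹ := by
      have := sub_pos.2 hlt
      positivity
    exact (hpos.trans_le (hF_compl _ _ hlt.le (min_le_right _ _))).trans_le <|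
      measureReal_mono hsub (measure_ne_top_of_subset sdiff_subset measure_Ioc_lt_top.ne)
  obtain ⟨e, he_neg, he_one, a, ha, he⟩ := exists_orderIso_sub_eq_volume_Ioc_diff
    hF.measurableSet hF.measure_ne_top hF_Ioc_pos
  have he_Icc : e '' Icc (-1) 1 = Icc (-1) 1 := by rw [OrderIso.image_Icc, he_neg, he_one]
  have he_null : volume (e '' F) = 0 := volume_image_eq_zero_of_sub_eq hF.measurableSet he
  have hHolder : ∃ K : ℝ≥0, HolderOnWith K α e.symm (Icc (-1) 1) := by
    rw [← he_Icc]
    refine exists_holderOnWith_symm (mul_pos ha hc) hα0.ne' fun x hx y hy hxy => ?_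
    rw [he x y hxy, mul_assoc]
    gcongr
    exact hF_compl x y hxy (by linarith [hx.1, hy.2])
  refine ⟨e.symm, (e.symm_apply_eq.2 he_neg.symm), (e.symm_apply_eq.2 he_one.symm), hHolder,
    F, hF_sub, hF, ?_, hF_pos, e.image_eq_preimage_symm F ▸ he_null⟩
  exact e.toHomeomorph.isEmbedding.isTotallyDisconnected
    (isTotallyDisconnected_of_volume_eq_zero he_null)

theorem isHomeoOn_of_bijOn {X Y : Type*} [TopologicalSpace X] [TopologicalSpace Y] [T2Space Y]
    {f : X → Y} {K : Set X} {L : Set Y} (hK : IsCompact K) (hf : ContinuousOn f K)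
    (hb : BijOn f K L) : IsHomeoOn f K L := by
  have : CompactSpace K := isCompact_iff_compactSpace.1 hK
  have hc : Continuous (hb.equiv f) :=
    (continuousOn_iff_continuous_domRestrict.1 hf).subtype_mk _
  exact ⟨hc.homeoOfEquivCompactToT2, fun _ => rfl⟩

theorem IsCantorSet.image {X Y : Type*} [TopologicalSpace X] [TopologicalSpace Y] [T2Space Y]
    {f : X → Y} {C : Set X} (hC : IsCantorSet C) (hf : ContinuousOn f C) (hi : InjOn f C) :
    IsCantorSet (f '' C) := by
  have hcompact : IsCompact (f '' C) := hC.isCompact.image_of_continuousOn hf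
  refine ⟨hC.nonempty.image f, hcompact, ⟨hcompact.isClosed, ?_⟩, ?_⟩
  · rintro _ ⟨x, hx, rfl⟩
    have hmaps : MapsTo f (C \ {x}) (f '' C \ {f x}) := fun y hy =>
      ⟨mem_image_of_mem f hy.1, fun hyx => hy.2 (hi hy.1 hx hyx)⟩
    have : (nhdsWithin x (C \ {x})).NeBot :=
      accPt_principal_iff_nhdsWithin.1 (hC.perfect.acc x hx)
    exact accPt_principal_iff_nhdsWithin.2
      (((hf x hx).mono sdiff_subset).tendsto_nhdsWithin hmaps).neBot
  · have : CompactSpace C := isCompact_iff_compactSpace.1 hC.isCompact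
    have hemb : Topology.IsClosedEmbedding fun x : C => f x :=
      (continuousOn_iff_continuous_domRestrict.1 hf).isClosedEmbedding (injOn_iff_injective.1 hi)
    rw [image_eq_range]
    exact hemb.isEmbedding.isTotallyDisconnected_range.2
      (totallyDisconnectedSpace_subtype_iff.2 hC.isTotallyDisconnected)

-- The perfect kernel of `A` differs from `A` by a countable set, whose image is negligible.
theorem exists_isCantorSet_subset {X Y : Type*} [TopologicalSpace X] [T2Space X]
    [SecondCountableTopology X] [MeasurableSpace Y] {μ : Measure Y} [NullSingletonClass μ]
    {A : Set X} {f : X → Y} (hA : IsCompact A) (hd : IsTotallyDisconnected A)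
    (hf : 0 < μ (f '' A)) :
    ∃ C ⊆ A, IsCantorSet C ∧ 0 < μ (f '' C) := by
  obtain ⟨V, C, hV, hC, rfl⟩ := exists_countable_union_perfect_of_isClosed hA.isClosed
  have hpos : 0 < μ (f '' C) := by
    rw [image_union] at hf
    exact hf.trans_le ((measure_union_le _ _).trans_eq (by
      rw [(hV.image f).measure_zero, zero_add]))
  have hne : C.Nonempty := nonempty_of_measure_ne_zero hpos.ne' |>.of_image
  exact ⟨C, subset_union_right, ⟨hne, hA.of_isClosed_subset hC.closed subset_union_right, hC,
    fun t ht => hd t (ht.trans subset_union_right)⟩, hpos⟩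

/-- The product of sets of real numbers, as a subset of Euclidean space. -/
def box {ι : Type*} (A : ι → Set ℝ) : Set (EuclideanSpace ℝ ι) :=
  {x | ∀ i, x i ∈ A i}

section Box

variable {ι : Type*} {A : ι → Set ℝ}

theorem box_eq_preimage_pi (A : ι → Set ℝ) : box A = WithLp.ofLp ⁻¹' univ.pi A := by
  ext x
  simp [box]

theorem isTotallyDisconnected_box (hA : ∀ i, IsTotallyDisconnected (A i)) :
    IsTotallyDisconnected (box A) := by
  intro t htA ht x hx y hy
  ext i
  have hcont : Continuous fun z : EuclideanSpace ℝ ι => z i := by fun_prop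
  refine hA i ((fun z : EuclideanSpace ℝ ι => z i) '' t) ?_ (ht.image _ hcont.continuousOn)
    (mem_image_of_mem _ hx) (mem_image_of_mem _ hy)
  rintro _ ⟨z, hz, rfl⟩
  exact htA hz i

theorem isCompact_box (hA : ∀ i, IsCompact (A i)) : IsCompact (box A) := by
  rw [box_eq_preimage_pi]
  exact (PiLp.homeomorph 2 fun _ : ι => ℝ).isCompact_preimage.2 (isCompact_univ_pi hA)

theorem isOpen_box [Finite ι] (hA : ∀ i, IsOpen (A i)) : IsOpen (box A) := by
  rw [box_eq_preimage_pi]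
  exact (isOpen_set_pi finite_univ fun i _ => hA i).preimage (by fun_prop)

theorem volume_box [Fintype ι] (hA : ∀ i, MeasurableSet (A i)) :
    volume (box A) = ∏ i, volume (A i) := by
  rw [box_eq_preimage_pi, (PiLp.volume_preserving_ofLp ι).measure_preimage
    (MeasurableSet.univ_pi hA).nullMeasurableSet, volume_pi_pi]

end Box

theorem isCompact_closedCube (n : ℕ) : IsCompact (closedCube n) :=
  isCompact_box fun _ => isCompact_Icc

theorem exists_abs_eq_one_of_mem_frontier {n : ℕ} {x : EuclideanSpace ℝ (Fin n)}
    (hx : x ∈ frontier (closedCube n)) : ∃ j, |x j| = 1 := by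
  have hmem : x ∈ closedCube n := (isCompact_closedCube n).isClosed.frontier_subset hx
  have hopen : IsOpen (openCube n) := isOpen_box fun _ => isOpen_Ioo
  have hsub : openCube n ⊆ interior (closedCube n) :=
    interior_maximal (fun y hy i => Ioo_subset_Icc_self (hy i)) hopen
  by_contra! hne
  exact hx.2 (hsub fun i => abs_lt.1 ((abs_le.2 (hmem i)).lt_of_ne (hne i)))

theorem exists_lintegral_norm_sub_rpow_le {E : Type*} [NormedAddCommGroup E] [NormedSpace ℝ E]
    [FiniteDimensional ℝ E] [Nontrivial E] [MeasurableSpace E] [BorelSpace E] {μ : Measure E}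
    [μ.IsAddHaarMeasure] {Ω : Set E} (hΩ : Bornology.IsBounded Ω) {a : ℝ}
    (ha : a < Module.finrank ℝ E) :
    ∃ M < ∞, ∀ x ∈ Ω, ∫⁻ y in Ω, ENNReal.ofReal (‖x - y‖ ^ (-a)) ∂μ ≤ M := by
  obtain ⟨R, hR⟩ := hΩ.subset_ball 0
  set φ : E → ℝ≥0∞ := (Metric.ball 0 (R + R)).indicator fun z => ENNReal.ofReal (‖z‖ ^ (-a))
    with hφ
  have hint : IntegrableOn (fun z : E => ‖z‖ ^ (-a)) (Metric.ball 0 (R + R)) μ :=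
    integrableOn_ball_of_norm_le_rpow (C := 1) Module.finrank_pos ha
      (Filter.Eventually.of_forall fun z => by
        rw [one_mul, Real.norm_of_nonneg (by positivity)])
      (measurable_norm.pow_const _).aestronglyMeasurable
  have hφ_meas : Measurable φ :=
    (measurable_norm.pow_const _).ennreal_ofReal.indicator measurableSet_ball
  refine ⟨∫⁻ z, φ z ∂μ, ?_, fun x hx => ?_⟩
  · rw [hφ, lintegral_indicator measurableSet_ball]
    exact hint.lintegral_lt_top
  · calc ∫⁻ y in Ω, ENNReal.ofReal (‖x - y‖ ^ (-a)) ∂μ ≤ ∫⁻ y in Ω, φ (x - y) ∂μ := by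
          refine setLIntegral_mono (hφ_meas.comp (by fun_prop)) fun y hy => ?_
          have hmem : x - y ∈ Metric.ball (0 : E) (R + R) := by
            rw [mem_ball_zero_iff]
            exact (norm_sub_le _ _).trans_lt
              (add_lt_add (mem_ball_zero_iff.1 (hR hx)) (mem_ball_zero_iff.1 (hR hy)))
          rw [hφ, indicator_of_mem hmem]
      _ ≤ ∫⁻ y, φ (x - y) ∂μ := setLIntegral_le_lintegral _ _
      _ = ∫⁻ z, φ z ∂μ := lintegral_sub_left_eq_self _ _

theorem norm_sub_rpow_div_le_of_holderOnWith {E F : Type*} [NormedAddCommGroup E]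
    [NormedAddCommGroup F] {f : E → F} {Ω : Set E} {K α : ℝ≥0} (hf : HolderOnWith K α f Ω)
    {x y : E} (hx : x ∈ Ω) (hy : y ∈ Ω) {p : ℝ} (hp : 0 < p) (t : ℝ) :
    ‖f x - f y‖ ^ p / ‖x - y‖ ^ t ≤ K ^ p * ‖x - y‖ ^ (-(t - α * p)) := by
  rcases eq_or_ne x y with rfl | hxy
  · rw [sub_self, norm_zero, Real.zero_rpow hp.ne', zero_div]
    positivity
  · have hd : 0 < ‖x - y‖ := norm_pos_iff.2 (sub_ne_zero.2 hxy)
    have hdist : ‖f x - f y‖ ≤ K * ‖x - y‖ ^ (α : ℝ) := by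
      simpa only [dist_eq_norm] using hf.dist_le hx hy
    calc ‖f x - f y‖ ^ p / ‖x - y‖ ^ t ≤ (K * ‖x - y‖ ^ (α : ℝ)) ^ p / ‖x - y‖ ^ t := by gcongr
      _ = K ^ p * ‖x - y‖ ^ (-(t - α * p)) := by
        rw [Real.mul_rpow (by positivity) (by positivity), ← Real.rpow_mul hd.le, mul_div_assoc,
          ← Real.rpow_sub hd, neg_sub]

theorem memFracSobolev_of_holderOnWith {n m : ℕ} (hn : n ≠ 0) {s p : ℝ} (hp : 0 < p)
    {Ω : Set (EuclideanSpace ℝ (Fin n))} (hΩ : IsCompact Ω)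
    {f : EuclideanSpace ℝ (Fin n) → EuclideanSpace ℝ (Fin m)} {K α : ℝ≥0} (hα0 : 0 < α)
    (hsα : s < α) (hf : HolderOnWith K α f Ω) : MemFracSobolev s p Ω f := by
  have : NeZero n := ⟨hn⟩
  constructor
  · have hcont : ContinuousOn f Ω := hf.continuousOn hα0
    have : IsFiniteMeasure (volume.restrict Ω) := isFiniteMeasure_restrict.2 hΩ.measure_ne_top
    obtain ⟨B, hB⟩ := hΩ.exists_bound_of_continuousOn hcont
    exact MemLp.of_bound (hcont.aestronglyMeasurable hΩ.measurableSet) B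
      (ae_restrict_of_forall_mem hΩ.measurableSet hB)
  · have hexp : n + s * p - α * p < Module.finrank ℝ (EuclideanSpace ℝ (Fin n)) := by
      rw [finrank_euclideanSpace_fin]
      nlinarith
    obtain ⟨M, hM_lt, hM⟩ := exists_lintegral_norm_sub_rpow_le (μ := volume) hΩ.isBounded hexp
    have hinner (x : EuclideanSpace ℝ (Fin n)) (hx : x ∈ Ω) :
        ∫⁻ y in Ω, ENNReal.ofReal (‖f x - f y‖ ^ p / ‖x - y‖ ^ ((n : ℝ) + s * p)) ≤
          ENNReal.ofReal (K ^ p) * M := by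
      calc _ ≤ ∫⁻ y in Ω, ENNReal.ofReal (K ^ p) *
            ENNReal.ofReal (‖x - y‖ ^ (-(n + s * p - α * p))) := by
            refine setLIntegral_mono' hΩ.measurableSet fun y hy => ?_
            rw [← ENNReal.ofReal_mul (by positivity)]
            exact ENNReal.ofReal_le_ofReal
              (norm_sub_rpow_div_le_of_holderOnWith hf hx hy hp _)
        _ ≤ ENNReal.ofReal (K ^ p) * M := by
            rw [lintegral_const_mul' _ _ ENNReal.ofReal_ne_top]
            gcongr
            exact hM x hx
    calc gagliardoEnergy s p Ω f ≤ ∫⁻ _ in Ω, ENNReal.ofReal (K ^ p) * M :=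
          setLIntegral_mono' hΩ.measurableSet hinner
      _ = ENNReal.ofReal (K ^ p) * M * volume Ω := setLIntegral_const _ _
      _ < ∞ := ENNReal.mul_lt_top (ENNReal.mul_lt_top ENNReal.ofReal_lt_top hM_lt)
          hΩ.measure_lt_top

section CoordMap

variable {n : ℕ}

/-- A cutoff in the coordinates other than `i`: it is `1` where all of them have absolute value at
most `1 / 2`, and `0` where one of them has absolute value at least `1`. The norm is the maximum
norm of `Fin n → ℝ`. -/
noncomputable def cutoff (i : Fin n) (x : EuclideanSpace ℝ (Fin n)) : ℝ :=
  projIcc 0 1 zero_le_one (2 - 2 * ‖Function.update x.ofLp i 0‖)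

theorem cutoff_mem_Icc (i : Fin n) (x : EuclideanSpace ℝ (Fin n)) : cutoff i x ∈ Icc 0 1 :=
  Subtype.prop _

theorem cutoff_congr {i : Fin n} {x y : EuclideanSpace ℝ (Fin n)} (h : ∀ j ≠ i, x j = y j) :
    cutoff i x = cutoff i y := by
  have hupdate : Function.update x.ofLp i 0 = Function.update y.ofLp i 0 := by
    ext j
    rcases eq_or_ne j i with rfl | hji
    · simp
    · simp [hji, h j hji]
  rw [cutoff, cutoff, hupdate]

theorem cutoff_eq_one {i : Fin n} {x : EuclideanSpace ℝ (Fin n)}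
    (h : ∀ j ≠ i, |x j| ≤ 1 / 2) : cutoff i x = 1 := by
  have hnorm : ‖Function.update x.ofLp i 0‖ ≤ 1 / 2 := by
    refine (pi_norm_le_iff_of_nonneg (by norm_num)).2 fun j => ?_
    rcases eq_or_ne j i with rfl | hji
    · simp
    · simpa [hji] using h j hji
  rw [cutoff, projIcc_of_right_le _ (by linarith)]

theorem cutoff_eq_zero {i j : Fin n} (hji : j ≠ i) {x : EuclideanSpace ℝ (Fin n)}
    (h : 1 ≤ |x j|) : cutoff i x = 0 := by
  have hnorm : |x j| ≤ ‖Function.update x.ofLp i 0‖ := by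
    simpa [hji] using norm_le_pi_norm (Function.update x.ofLp i 0) j
  rw [cutoff, projIcc_of_le_left _ (by linarith)]

theorem lipschitzWith_cutoff (i : Fin n) : LipschitzWith 2 (cutoff i) := by
  refine LipschitzWith.of_dist_le_mul fun x y => ?_
  have hupdate : ‖Function.update x.ofLp i 0 - Function.update y.ofLp i 0‖ ≤ ‖x - y‖ := by
    refine (pi_norm_le_iff_of_nonneg (norm_nonneg _)).2 fun j => ?_
    rcases eq_or_ne j i with rfl | hji
    · simp
    · simpa [hji] using PiLp.norm_apply_le (x - y) j
  calc dist (cutoff i x) (cutoff i y)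
      ≤ |(2 - 2 * ‖Function.update x.ofLp i 0‖) - (2 - 2 * ‖Function.update y.ofLp i 0‖)| := by
        simpa only [NNReal.coe_one, one_mul] using!
          (LipschitzWith.projIcc zero_le_one).dist_le_mul
            (2 - 2 * ‖Function.update x.ofLp i 0‖) (2 - 2 * ‖Function.update y.ofLp i 0‖)
    _ = 2 * |‖Function.update x.ofLp i 0‖ - ‖Function.update y.ofLp i 0‖| := by
        rw [sub_sub_sub_cancel_left, ← mul_sub, abs_mul, abs_two, abs_sub_comm]
    _ ≤ 2 * ‖x - y‖ := by
        gcongr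
        exact (abs_norm_sub_norm_le _ _).trans hupdate
    _ = (2 : ℝ≥0) * dist x y := by rw [dist_eq_norm, NNReal.coe_ofNat]

/-- The map applying `g` to the coordinate `i`, damped by the cutoff in the other coordinates so
that it becomes the identity on the faces of the cube. -/
noncomputable def coordMap (g : ℝ → ℝ) (i : Fin n) (x : EuclideanSpace ℝ (Fin n)) :
    EuclideanSpace ℝ (Fin n) :=
  x + EuclideanSpace.single i (cutoff i x * (g (x i) - x i))

variable {g : ℝ → ℝ} {i : Fin n} {x y : EuclideanSpace ℝ (Fin n)}

theorem coordMap_apply_self (g : ℝ → ℝ) (i : Fin n) (x : EuclideanSpace ℝ (Fin n)) :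
    coordMap g i x i = AffineMap.lineMap (x i) (g (x i)) (cutoff i x) := by
  simp [coordMap, AffineMap.lineMap_apply, add_comm]

theorem coordMap_apply_of_ne (g : ℝ → ℝ) {i j : Fin n} (hji : j ≠ i)
    (x : EuclideanSpace ℝ (Fin n)) : coordMap g i x j = x j := by
  simp [coordMap, hji]

theorem continuous_coordMap (hg : Continuous g) (i : Fin n) : Continuous (coordMap g i) := by
  have hcutoff : Continuous (cutoff i) := (lipschitzWith_cutoff i).continuous
  refine (PiLp.homeomorph 2 fun _ : Fin n => ℝ).comp_continuous_iff.1 (continuous_pi fun j => ?_)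
  change Continuous fun x => coordMap g i x j
  rcases eq_or_ne j i with rfl | hji
  · simp only [coordMap_apply_self, AffineMap.lineMap_apply_module]
    fun_prop
  · simp only [coordMap_apply_of_ne g hji]
    fun_prop

theorem coordMap_eq_self (hg_neg : g (-1) = -1) (hg_one : g 1 = 1) {j : Fin n}
    (hj : |x j| = 1) : coordMap g i x = x := by
  have hzero : cutoff i x * (g (x i) - x i) = 0 := by
    rcases eq_or_ne j i with rfl | hji
    · rcases eq_or_eq_neg_of_abs_eq hj with h | h <;> simp [h, hg_neg, hg_one]
    · rw [cutoff_eq_zero hji hj.ge, zero_mul]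
  simp [coordMap, hzero]

theorem exists_coordMap_eq {u : ℝ} (hu : AffineMap.lineMap u (g u) (cutoff i y) = y i) :
    ∃ x, x i = u ∧ (∀ j ≠ i, x j = y j) ∧ coordMap g i x = y := by
  set x : EuclideanSpace ℝ (Fin n) := WithLp.toLp 2 (Function.update y.ofLp i u)
  have hxi : x i = u := by simp [x]
  have hxj (j : Fin n) (hji : j ≠ i) : x j = y j := by simp [x, hji]
  refine ⟨x, hxi, hxj, ?_⟩
  ext j
  rcases eq_or_ne j i with rfl | hji
  · rw [coordMap_apply_self, hxi, cutoff_congr hxj, hu]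
  · rw [coordMap_apply_of_ne g hji, hxj j hji]

theorem strictMono_lineMap_id {g : ℝ → ℝ} (hg : StrictMono g) {t : ℝ} (ht : t ∈ Icc 0 1) :
    StrictMono fun u => AffineMap.lineMap u (g u) t := fun _ _ huv =>
  lineMap_strict_mono_endpoints huv (hg huv) ht.1 ht.2

theorem injective_coordMap (hg : StrictMono g) (i : Fin n) :
    Function.Injective (coordMap g i) := by
  intro x y hxy
  have hj (j : Fin n) (hji : j ≠ i) : x j = y j := by
    rw [← coordMap_apply_of_ne g hji x, hxy, coordMap_apply_of_ne g hji y]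
  have hi : x i = y i := by
    refine (strictMono_lineMap_id hg (cutoff_mem_Icc i x)).injective ?_
    have h := congrArg (· i) hxy
    simpa only [coordMap_apply_self, ← cutoff_congr hj] using h
  ext j
  rcases eq_or_ne j i with rfl | hji
  exacts [hi, hj j hji]

theorem bijOn_coordMap (hg : StrictMono g) (hg_cont : Continuous g) (hg_neg : g (-1) = -1)
    (hg_one : g 1 = 1) (i : Fin n) : BijOn (coordMap g i) (closedCube n) (closedCube n) := by
  have hg_maps {u : ℝ} (hu : u ∈ Icc (-1) 1) : g u ∈ Icc (-1) 1 :=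
    ⟨hg_neg ▸ hg.monotone hu.1, hg_one ▸ hg.monotone hu.2⟩
  refine ⟨fun x hx j => ?_, (injective_coordMap hg i).injOn, fun y hy => ?_⟩
  · rcases eq_or_ne j i with rfl | hji
    · rw [coordMap_apply_self]
      exact (convex_Icc _ _).lineMap_mem (hx j) (hg_maps (hx j)) (cutoff_mem_Icc j x)
    · rw [coordMap_apply_of_ne g hji]
      exact hx j
  · have hcont : ContinuousOn (fun u => AffineMap.lineMap u (g u) (cutoff i y)) (Icc (-1) 1) := by
      simp only [AffineMap.lineMap_apply_module]
      fun_prop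
    have hsurj := intermediate_value_Icc (by norm_num) hcont
    simp only [hg_neg, hg_one, AffineMap.lineMap_same_apply] at hsurj
    obtain ⟨u, hu, huy⟩ := hsurj (hy i)
    obtain ⟨x, hxi, hxj, hxy⟩ := exists_coordMap_eq huy
    refine ⟨x, fun j => ?_, hxy⟩
    rcases eq_or_ne j i with rfl | hji
    · rwa [hxi]
    · rw [hxj j hji]
      exact hy j

theorem norm_coordMap_sub_le (hg : MapsTo g (Icc (-1) 1) (Icc (-1) 1)) (hy : y ∈ closedCube n) :
    ‖coordMap g i x - coordMap g i y‖ ≤ 6 * ‖x - y‖ + |g (x i) - g (y i)| := by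
  have hcoord : |x i - y i| ≤ ‖x - y‖ := PiLp.norm_apply_le (x - y) i
  have hcutoff : |cutoff i x - cutoff i y| ≤ 2 * ‖x - y‖ := by
    simpa [dist_eq_norm] using (lipschitzWith_cutoff i).dist_le_mul x y
  have hdispl : |g (y i) - y i| ≤ 2 := by
    have hgy := hg (hy i)
    exact abs_le.2 ⟨by linarith [hgy.1, (hy i).2], by linarith [hgy.2, (hy i).1]⟩
  have hsplit : cutoff i x * (g (x i) - x i) - cutoff i y * (g (y i) - y i) =
      cutoff i x * ((g (x i) - g (y i)) - (x i - y i)) +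
        (cutoff i x - cutoff i y) * (g (y i) - y i) := by ring
  calc ‖coordMap g i x - coordMap g i y‖
      = ‖(x - y) + EuclideanSpace.single i
          (cutoff i x * (g (x i) - x i) - cutoff i y * (g (y i) - y i))‖ := by
        rw [coordMap, coordMap, add_sub_add_comm]
        exact congrArg (‖x - y + ·‖) (PiLp.single_sub (β := fun _ => ℝ) 2 i).symm
    _ ≤ ‖x - y‖ + |cutoff i x * (g (x i) - x i) - cutoff i y * (g (y i) - y i)| :=
        (norm_add_le _ _).trans_eq (by rw [PiLp.norm_single, Real.norm_eq_abs])
    _ ≤ ‖x - y‖ + (1 * (|g (x i) - g (y i)| + |x i - y i|) + 2 * ‖x - y‖ * 2) := by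
        rw [hsplit]
        refine add_le_add_right ((abs_add_le _ _).trans ?_) _
        rw [abs_mul, abs_mul, abs_of_nonneg (cutoff_mem_Icc i x).1]
        gcongr
        exacts [(cutoff_mem_Icc i x).2, abs_sub _ _]
    _ ≤ 6 * ‖x - y‖ + |g (x i) - g (y i)| := by linarith

theorem exists_holderOnWith_coordMap (hg : MapsTo g (Icc (-1) 1) (Icc (-1) 1)) {K α : ℝ≥0}
    (hα : α ≤ 1) (hgα : HolderOnWith K α g (Icc (-1) 1)) (i : Fin n) :
    ∃ K' : ℝ≥0, HolderOnWith K' α (coordMap g i) (closedCube n) := by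
  obtain ⟨D, hD⟩ := Metric.isBounded_iff_nndist.1 (isCompact_closedCube n).isBounded
  obtain ⟨L, hL⟩ : ∃ L : ℝ≥0, HolderOnWith L α id (closedCube n) :=
    ⟨_, (holderOnWith_one.2 LipschitzWith.id.lipschitzOnWith).of_le
      (fun x hx y hy => by
        rw [edist_nndist]
        exact_mod_cast hD hx hy) hα⟩
  refine ⟨6 * L + K, holderOnWith_of_dist_le fun x hx y hy => ?_⟩
  have hcoord : dist (x i) (y i) ≤ dist x y := by
    rw [dist_eq_norm, dist_eq_norm]
    exact PiLp.norm_apply_le (x - y) i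
  calc dist (coordMap g i x) (coordMap g i y) ≤ 6 * dist x y + dist (g (x i)) (g (y i)) := by
        rw [dist_eq_norm, dist_eq_norm, Real.dist_eq]
        exact norm_coordMap_sub_le hg hy
    _ ≤ 6 * (L * dist x y ^ (α : ℝ)) + K * dist x y ^ (α : ℝ) := by
        gcongr
        · exact hL.dist_le hx hy
        · exact (hgα.dist_le (hx i) (hy i)).trans (by gcongr)
    _ = (6 * L + K : ℝ≥0) * dist x y ^ (α : ℝ) := by
        push_cast
        ring

theorem box_subset_image_coordMap {A : Fin n → Set ℝ} (hA : ∀ j ≠ i, A j ⊆ Icc (-1 / 2) (1 / 2))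
    (hAi : A i ⊆ range g) :
    box A ⊆ coordMap g i '' box (Function.update A i (g ⁻¹' A i)) := by
  intro y hy
  obtain ⟨u, hu⟩ := hAi (hy i)
  have hcutoff : cutoff i y = 1 := cutoff_eq_one fun j hji =>
    abs_le.2 ⟨by linarith [(hA j hji (hy j)).1], (hA j hji (hy j)).2⟩
  obtain ⟨x, hxi, hxj, hxy⟩ := exists_coordMap_eq (g := g) (i := i) (y := y) (u := u)
    (by rw [hcutoff, AffineMap.lineMap_apply_one, hu])
  refine ⟨x, fun j => ?_, hxy⟩
  rcases eq_or_ne j i with rfl | hji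
  · rw [Function.update_self, mem_preimage, hxi, hu]
    exact hy j
  · rw [Function.update_of_ne hji, hxj j hji]
    exact hy j

theorem exists_isCantorSet_volume_image_coordMap_pos {g : ℝ ≃o ℝ} (hg_neg : g (-1) = -1)
    (hg_one : g 1 = 1) {F : Set ℝ} (hF_sub : F ⊆ Icc (-1 / 2) (1 / 2)) (hF : IsCompact F)
    (hF_disc : IsTotallyDisconnected F) (hF_pos : 0 < volume F)
    (hF_null : volume (g ⁻¹' F) = 0) (i : Fin n) :
    ∃ C ⊆ openCube n, IsCantorSet C ∧ volume C = 0 ∧ 0 < volume (coordMap g i '' C) := by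
  set A : Fin n → Set ℝ := Function.update (fun _ => F) i (g ⁻¹' F)
  have hA {P : Set ℝ → Prop} (hFP : P F) (hgP : P (g ⁻¹' F)) (j : Fin n) : P (A j) := by
    rcases eq_or_ne j i with rfl | hji
    · simpa [A] using hgP
    · simpa [A, hji] using hFP
  have hA_compact (j : Fin n) : IsCompact (A j) :=
    hA hF (g.toHomeomorph.isCompact_preimage.2 hF) j
  have hA_sub (j : Fin n) : A j ⊆ Ioo (-1) 1 := by
    have hF_Ioo : F ⊆ Ioo (-1) 1 := hF_sub.trans (Icc_subset_Ioo (by norm_num) (by norm_num))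
    have hpre : g ⁻¹' F ⊆ Ioo (-1) 1 := fun u hu =>
      ⟨g.lt_iff_lt.1 (hg_neg.symm ▸ (hF_Ioo hu).1), g.lt_iff_lt.1 (hg_one.symm ▸ (hF_Ioo hu).2)⟩
    exact hA (P := (· ⊆ Ioo (-1) 1)) hF_Ioo hpre j
  have hA_null : volume (box A) = 0 := by
    rw [volume_box fun j => (hA_compact j).measurableSet]
    exact Finset.prod_eq_zero (Finset.mem_univ i) (by simpa [A] using hF_null)
  have himage_pos : 0 < volume (coordMap g i '' box A) := by
    refine lt_of_lt_of_le ?_ (measure_mono (box_subset_image_coordMap (A := fun _ => F)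
      (fun _ _ => hF_sub) (g.surjective.range_eq ▸ subset_univ F)))
    rw [volume_box fun _ => hF.measurableSet]
    exact CanonicallyOrderedAdd.prod_pos.2 fun _ _ => hF_pos
  have : NeZero n := NeZero.of_pos i.pos
  obtain ⟨C, hC_sub, hC, hC_pos⟩ := exists_isCantorSet_subset (isCompact_box hA_compact)
    (isTotallyDisconnected_box (hA hF_disc (isTotallyDisconnected_of_volume_eq_zero hF_null)))
    himage_pos
  exact ⟨C, fun x hx j => hA_sub j (hC_sub hx j), hC, measure_mono_null hC_sub hA_null, hC_pos⟩

end CoordMap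

theorem theorem1p2_general {n : ℕ} (hn : n ≠ 0) {α : ℝ≥0} (hα0 : 0 < α) (hα1 : α < 1) :
    ∃ f : EuclideanSpace ℝ (Fin n) → EuclideanSpace ℝ (Fin n),
      IsHomeoOn f (closedCube n) (closedCube n) ∧
      (∀ s p : ℝ, s < α → 0 < p → MemFracSobolev s p (closedCube n) f) ∧
      (∀ x ∈ frontier (closedCube n), f x = x) ∧
      ¬ LusinN f (openCube n) ∧
      (∃ K : ℝ≥0, HolderOnWith K α f (closedCube n)) ∧
      (∃ C ⊆ openCube n, IsCantorSet C ∧ volume C = 0 ∧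
        IsCantorSet (f '' C) ∧ 0 < volume (f '' C)) := by
  have : NeZero n := ⟨hn⟩
  obtain ⟨g, hg_neg, hg_one, ⟨K, hK⟩, F, hF_sub, hF, hF_disc, hF_pos, hF_null⟩ :=
    exists_orderIso_holderOnWith hα0 hα1
  have hcont : Continuous (coordMap g (0 : Fin n)) := continuous_coordMap g.continuous 0
  have hbij := bijOn_coordMap g.strictMono g.continuous hg_neg hg_one (0 : Fin n)
  obtain ⟨K', hK'⟩ := exists_holderOnWith_coordMap
    (fun u hu => ⟨hg_neg ▸ g.monotone hu.1, hg_one ▸ g.monotone hu.2⟩) hα1.le hK (0 : Fin n)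
  obtain ⟨C, hC_sub, hC, hC_null, hC_pos⟩ := exists_isCantorSet_volume_image_coordMap_pos
    hg_neg hg_one hF_sub hF hF_disc hF_pos hF_null (0 : Fin n)
  exact ⟨coordMap g 0, isHomeoOn_of_bijOn (isCompact_closedCube n) hcont.continuousOn hbij,
    fun s p hs hp => memFracSobolev_of_holderOnWith hn hp (isCompact_closedCube n) hα0 hs hK',
    fun x hx => (exists_abs_eq_one_of_mem_frontier hx).elim fun j => coordMap_eq_self hg_neg hg_one,
    fun hN => hC_pos.ne' (hN C hC_sub hC_null), ⟨K', hK'⟩, C, hC_sub, hC, hC_null,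
    hC.image hcont.continuousOn (injective_coordMap g.strictMono 0).injOn, hC_pos⟩

theorem theorem1p2 (n : ℕ) (hn : 2 ≤ n) (s : ℝ) (hs0 : 0 < s) (hs1 : s < 1)
    (p : ℝ) (hp : 1 < p) :
    ∃ f : EuclideanSpace ℝ (Fin n) → EuclideanSpace ℝ (Fin n),
      IsHomeoOn f (closedCube n) (closedCube n) ∧
      MemFracSobolev s p (closedCube n) f ∧
      (∀ x ∈ frontier (closedCube n), f x = x) ∧
      ¬ LusinN f (openCube n) ∧
      (∃ α : ℝ≥0, s < α ∧ α < 1 ∧ ∃ K : ℝ≥0, HolderOnWith K α f (closedCube n)) ∧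
      (∃ C ⊆ openCube n, IsCantorSet C ∧ volume C = 0 ∧
        IsCantorSet (f '' C) ∧ 0 < volume (f '' C)) := by
  obtain ⟨α, hsα, hα1⟩ := exists_between hs1
  lift α to ℝ≥0 using (hs0.trans hsα).le
  obtain ⟨f, hf, hfS, hf_frontier, hfN, hfα, hfC⟩ := theorem1p2_general (n := n) (by omega)
    (NNReal.coe_pos.1 (hs0.trans hsα)) (NNReal.coe_lt_one.1 hα1)
  exact ⟨f, hf, hfS s p hsα (zero_lt_one.trans hp), hf_frontier, hfN, ⟨α, hsα, hα1, hfα⟩, hfC⟩
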